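/- Let $\Gamma$ be a non-elementary hyperbolic group (that is, a finitely generated group which has a hyperbolic Cayley graph with respect to some finite set of generators, and which has no cyclic subgroup of finite index), and let $d$ be a left-invariant hyperbolic metric on $\Gamma$ that is quasi-isometric (via the identity) to a word metric. Here a metric $d$ is hyperbolic if, for some basepoint $o$, the Gromov product $(x,y)_o=\tfrac12(d(x,o)+d(y,o)-d(x,y))$ satisfies $(x,y)_o\ge\min\{(x,z)_o,(y,z)_o\}-\delta$ for some $\delta$ and all $x,y,z$. Take $1\in\Gamma$ as the basepoint, write $|g|=d(g,1)$ and $(g,h)=(g,h)_1$, let $\partial\Gamma$ be the Gromov boundary of $(\Gamma,d)$ (sequences with $(x_i,x_j)\to\infty$ as $i,j\to\infty$, modulo the relation $(x_n,y_n)\to\infty$), and extend the Gromov product to $\Gamma\cup\partial\Gamma$ by $(x,y)=\sup\liminf_{i,j\to\infty}(x_i,y_j)$, the supremum being over all sequences $(x_i)$, $(y_j)$ representing $x$ and $y$ (points of $\Gamma$ are represented by constant sequences). For $R,r>0$ let $$A_R=A_{R,r}=\{g\in\Gamma : R-r\le |g|\le R+r\}.$$ There is $r_0>0$, depending only on $(\Gamma,d)$,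 such that the following holds for every $r\ge r_0$. Let $\epsilon>0$, let $d_\epsilon$ be a visual metric on $\partial\Gamma$ with parameter $\epsilon$, i.e. a metric for which there is $C>0$ with $C^{-1}e^{-\epsilon(\xi,\eta)}\le d_\epsilon(\xi,\eta)\le C e^{-\epsilon(\xi,\eta)}$ for all $\xi,\eta\in\partial\Gamma$ (where $e^{-\infty}=0$), and for every $g\in\Gamma$ let $\hat g\in\partial\Gamma$ be a point such that $\bigl|(g,\hat g)-|g|\bigr|$ is bounded uniformly in $g$. Put $\check g=\widehat{g^{-1}}$ and, for $\rho>0$, $$\Sigma_2(g,\rho)=B_{\partial\Gamma}\bigl(\hat g,e^{-\epsilon(|g|/2-\rho)}\bigr)\times B_{\partial\Gamma}\bigl(\check g,e^{-\epsilon(|g|/2-\rho)}\bigr)\subseteq\partial\Gamma\times\partial\Gamma,$$ where $B_{\partial\Gamma}$ denotes closed balls with respect to $d_\epsilon$. Then there is $\rho_0>0$ such that for every $\rho\ge\rho_0$ and every $R>0$, $$\bigcup_{g\in A_R}\Sigma_2(g,\rho)=\partial\Gamma\times\partial\Gamma .$$ -/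

import Mathlib

open Filter Topology

namespace BoundaryRep

noncomputable section

/-- The Gromov product `(x, y)_o = (d(x,o) + d(y,o) - d(x,y)) / 2` with respect to the distance
function `d` and the basepoint `o`. -/
def gromovProduct {X : Type*} (d : X → X → ℝ) (o x y : X) : ℝ :=
  (d x o + d y o - d x y) / 2

/-- The distance function `d` is (Gromov) hyperbolic: for some basepoint,
`(x, y)_o ≥ min {(x, z)_o, (y, z)_o} - δ` uniformly in `x, y, z`. -/
def IsHyperbolicDist {X : Type*} (d : X → X → ℝ) : Prop :=
  ∃ (o : X) (δ : ℝ), ∀ x y z : X,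
    min (gromovProduct d o x z) (gromovProduct d o y z) - δ ≤ gromovProduct d o x y

/-- `S` is a finite set of generators of the group `Γ`. -/
def IsFiniteGenerating {Γ : Type*} [Group Γ] (S : Set Γ) : Prop :=
  S.Finite ∧ Subgroup.closure S = ⊤

/-- The word metric of the set `S` (used for generating sets `S`): the path metric of the Cayley
graph of `Γ` with respect to `S`, on the set `Γ` of its vertices. -/
def wordDist {Γ : Type*} [Group Γ] (S : Set Γ) (g h : Γ) : ℝ :=
  ((SimpleGraph.mulCayley S).dist g h : ℝ)

/-- `Γ` is a hyperbolic group: it has a finite set of generators whose Cayley graph is hyperbolic.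
Hyperbolicity is expressed by Gromov products of vertices; every point of the geometric realization
of the graph is within `1/2` of a vertex, so this only affects the additive constant. -/
def IsHyperbolicGroup (Γ : Type*) [Group Γ] : Prop :=
  ∃ S : Set Γ, IsFiniteGenerating S ∧ IsHyperbolicDist (wordDist S)

/-- `Γ` is non-elementary: it does not contain a cyclic subgroup of finite index. -/
def IsNonElementary (Γ : Type*) [Group Γ] : Prop :=
  ¬ ∃ H : Subgroup Γ, IsCyclic H ∧ H.FiniteIndex

/-- Two distance functions on the same set are quasi-isometric: the identity is a
quasi-isometry. -/
def QuasiIsometricDist {X : Type*} (d d' : X → X → ℝ) : Prop :=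
  ∃ L C : ℝ, 1 ≤ L ∧ 0 ≤ C ∧
    ∀ x y : X, 1 / L * d x y - C ≤ d' x y ∧ d' x y ≤ L * d x y + C

/-- The metric of `Γ` belongs to the class `𝒟(Γ)`: it is left-invariant, hyperbolic, and
quasi-isometric to a word metric. -/
structure MetricInClassD (Γ : Type*) [Group Γ] [MetricSpace Γ] : Prop where
  left_invariant : ∀ a g h : Γ, dist (a * g) (a * h) = dist g h
  hyperbolic : IsHyperbolicDist (fun g h : Γ => dist g h)
  quasiIsometric : ∃ S : Set Γ, IsFiniteGenerating S ∧
    QuasiIsometricDist (wordDist S) (fun g h : Γ => dist g h)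

section Boundary

variable {X : Type*} [MetricSpace X]

/-- The sequence `x` tends to infinity: `(x_i, x_j)_o → ∞` as `i, j → ∞`. -/
def TendsToInfinity (o : X) (x : ℕ → X) : Prop :=
  Tendsto (fun p : ℕ × ℕ => gromovProduct dist o (x p.1) (x p.2)) atTop atTop

/-- Sequences tending to infinity. -/
def SeqToInfinity (o : X) : Type _ := {x : ℕ → X // TendsToInfinity o x}

/-- Two sequences tending to infinity are equivalent if `(x_n, y_n)_o → ∞`. -/
def SeqEquiv (o : X) (x y : SeqToInfinity o) : Prop :=
  Tendsto (fun n : ℕ => gromovProduct dist o (x.1 n) (y.1 n)) atTop atTop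

/-- The Gromov boundary of `X`: classes of sequences tending to infinity. In a hyperbolic
space `SeqEquiv` is an equivalence relation, see `mk_eq_mk_iff` below. -/
def GromovBoundary (o : X) : Type _ := Quot (SeqEquiv o)

/-- `Represents o p s`: the sequence `s` represents the point `p` of `X ∪ ∂X`. Points of `X`
are represented by constant sequences only. -/
def Represents (o : X) : X ⊕ GromovBoundary o → (ℕ → X) → Prop
  | Sum.inl x, s => ∀ n, s n = x
  | Sum.inr ξ, s => ∃ h : TendsToInfinity o s, Quot.mk (SeqEquiv o) ⟨s, h⟩ = ξ

/-- The extended Gromov product on `X ∪ ∂X`: the supremum of `liminf_{i,j} (x_i, y_j)_o` over all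
representatives `x` of `p` and `y` of `q`. It takes the value `⊤` for `p = q ∈ ∂X`. -/
def extGromovProduct (o : X) (p q : X ⊕ GromovBoundary o) : EReal :=
  ⨆ (s : ℕ → X) (t : ℕ → X) (_ : Represents o p s) (_ : Represents o q t),
    liminf (fun ij : ℕ × ℕ => (gromovProduct dist o (s ij.1) (t ij.2) : EReal)) atTop

/-- The metric of the boundary is a visual metric with parameter `ε`:
`d_ε(ξ, η) ≍ exp (-ε (ξ, η))`, where `exp (-∞) = 0`. (This estimate forces the metric to induce
the usual topology of the boundary.) -/
def IsVisualMetric (o : X) [MetricSpace (GromovBoundary o)] (ε : ℝ) : Prop :=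
  ∃ C : ℝ, 0 < C ∧ ∀ ξ η : GromovBoundary o,
    edist ξ η ≤ ENNReal.ofReal C *
        EReal.exp (-((ε : EReal) * extGromovProduct o (Sum.inr ξ) (Sum.inr η))) ∧
    EReal.exp (-((ε : EReal) * extGromovProduct o (Sum.inr ξ) (Sum.inr η))) ≤
        ENNReal.ofReal C * edist ξ η

/-- Hyperbolicity does not depend on the basepoint. -/
theorem hyperbolic_basepoint (h : IsHyperbolicDist (fun x y : X => dist x y)) (o : X) :
    ∃ δ : ℝ, ∀ x y z : X, min (gromovProduct dist o x z) (gromovProduct dist o y z) - δ ≤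
      gromovProduct dist o x y := by
  obtain ⟨p, δ, h⟩ := h
  have key : ∀ x y : X, |gromovProduct dist o x y - gromovProduct dist p x y| ≤ dist o p := by
    intro x y
    have h1 := dist_triangle x p o
    have h2 := dist_triangle x o p
    have h3 := dist_triangle y p o
    have h4 := dist_triangle y o p
    rw [dist_comm p o] at h1 h3
    rw [abs_le]
    unfold gromovProduct
    constructor <;> linarith
  refine ⟨δ + 2 * dist o p, fun x y z => ?_⟩
  have hxyz := h x y z
  have h1 := abs_le.1 (key x y)
  have h2 := abs_le.1 (key x z)
  have h3 := abs_le.1 (key y z)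
  change min (gromovProduct dist p x z) (gromovProduct dist p y z) - δ ≤
    gromovProduct dist p x y at hxyz
  have h4 : min (gromovProduct dist o x z) (gromovProduct dist o y z) - dist o p ≤
      min (gromovProduct dist p x z) (gromovProduct dist p y z) := by
    apply le_min
    · linarith [min_le_left (gromovProduct dist o x z) (gromovProduct dist o y z)]
    · linarith [min_le_right (gromovProduct dist o x z) (gromovProduct dist o y z)]
  linarith

theorem seqEquiv_equivalence (h : IsHyperbolicDist (fun x y : X => dist x y)) (o : X) :
    Equivalence (SeqEquiv o) := by
  obtain ⟨δ, h⟩ := hyperbolic_basepoint h o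
  have hsymm : ∀ x y : X, gromovProduct dist o x y = gromovProduct dist o y x := by
    intro x y
    unfold gromovProduct
    rw [dist_comm x y]
    ring
  refine ⟨fun x => ?_, fun {x y} hxy => ?_, fun {x y z} hxy hyz => ?_⟩
  · have hx : Tendsto (fun p : ℕ × ℕ => gromovProduct dist o (x.1 p.1) (x.1 p.2)) atTop atTop :=
      x.2
    have hdiag : Tendsto (fun n : ℕ => (n, n)) atTop (atTop : Filter (ℕ × ℕ)) :=
      tendsto_atTop_diagonal
    exact hx.comp hdiag
  · unfold SeqEquiv at hxy ⊢
    simpa only [hsymm] using hxy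
  · unfold SeqEquiv at hxy hyz ⊢
    rw [tendsto_atTop] at hxy hyz ⊢
    intro b
    filter_upwards [hxy (b + δ), hyz (b + δ)] with n h1 h2
    have h3 := h (x.1 n) (z.1 n) (y.1 n)
    rw [hsymm (z.1 n)] at h3
    linarith [le_min h1 h2]

/-- In a hyperbolic space, points of the boundary are precisely equivalence classes. -/
theorem mk_eq_mk_iff (h : IsHyperbolicDist (fun x y : X => dist x y)) (o : X)
    (x y : SeqToInfinity o) :
    Quot.mk (SeqEquiv o) x = Quot.mk (SeqEquiv o) y ↔ SeqEquiv o x y := by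
  constructor
  · intro hxy
    exact ((seqEquiv_equivalence h o).eqvGen_iff).1 (Quot.eqvGen_exact hxy)
  · exact fun hxy => Quot.sound hxy

end Boundary

section Group

variable {Γ : Type*} [Group Γ] [MetricSpace Γ]

/-- The length `|g| = d(g, 1)`. -/
def len (g : Γ) : ℝ := dist g 1

/-- `hat` is a choice of boundary points `ĝ` with `(g, ĝ) ≈ |g|` uniformly in `g ∈ Γ`. -/
def IsHatMap (hat : Γ → GromovBoundary (1 : Γ)) : Prop :=
  ∃ C : ℝ, ∀ g : Γ,
    ((len g - C : ℝ) : EReal) ≤ extGromovProduct 1 (Sum.inl g) (Sum.inr (hat g)) ∧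
    extGromovProduct 1 (Sum.inl g) (Sum.inr (hat g)) ≤ ((len g + C : ℝ) : EReal)

/-- The annulus `A_R = {g : R - r ≤ |g| ≤ R + r}` of thickness `r`. -/
def annulus (Γ : Type*) [Group Γ] [MetricSpace Γ] (r R : ℝ) : Set Γ :=
  {g | R - r ≤ len g ∧ len g ≤ R + r}

/-- The double shadow `Σ₂(g, ρ)`, the product of the closed balls of radius `e^{-ε(|g|/2 - ρ)}`
around `ĝ` and around `ǧ`, where `ǧ` is the point chosen for `g⁻¹`. -/
def doubleShadow [MetricSpace (GromovBoundary (1 : Γ))] (ε : ℝ)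
    (hat : Γ → GromovBoundary (1 : Γ)) (g : Γ) (ρ : ℝ) :
    Set (GromovBoundary (1 : Γ) × GromovBoundary (1 : Γ)) :=
  Metric.closedBall (hat g) (Real.exp (-(ε * (len g / 2 - ρ)))) ×ˢ
    Metric.closedBall (hat g⁻¹) (Real.exp (-(ε * (len g / 2 - ρ))))

end Group

end

end BoundaryRep

/-! Given boundary points `ξ`, `η` and `R`, choose `x`, `y` in `Γ` of length about `R/2` in the
directions of `ξ` and `η`, and put `g = x f y⁻¹` with `f` bounded. If `(x⁻¹, f y⁻¹)` is bounded, no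
cancellation occurs: `|g|` is about `R`, `g` follows `x` up to `R/2`, and `g⁻¹` follows `y` up to
`R/2`. The four-point inequality then bounds `(ĝ, ξ)` and `(ǧ, η)` below by `R/2` minus a constant,
which the visual metric turns into membership in the two balls.

The points `x`, `y` exist because `d` is roughly geodesic (`exists_point_toward`): word geodesics
are quasi-geodesics for `d`, and these are stable (`exists_quasiGeodesic_bound`). The element `f`
comes from non-elementarity (`exists_finite_gromovProduct_le`): if no bounded `f` worked, `Γ` would
fix a direction at infinity, and the Busemann function there would be a quasimorphism with finite
sublevel sets, forcing `Γ` to be virtually cyclic. -/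

namespace BoundaryRep

/-! ### Stability of quasi-geodesics from the four-point inequality -/

section Morse

variable {X : Type*} [MetricSpace X]

/-- The four point inequality holds with the constant `δ` at every basepoint. -/
def FourPoint (X : Type*) [MetricSpace X] (δ : ℝ) : Prop :=
  ∀ o x y z : X, min (gromovProduct dist o x z) (gromovProduct dist o y z) - δ ≤
    gromovProduct dist o x y

theorem gromovProduct_symm (o x y : X) :
    gromovProduct dist o x y = gromovProduct dist o y x := by
  unfold gromovProduct
  rw [dist_comm x y]
  ring

theorem gromovProduct_le_left (o x y : X) : gromovProduct dist o x y ≤ dist x o := by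
  have := dist_triangle y x o
  rw [dist_comm y x] at this
  unfold gromovProduct
  linarith

theorem gromovProduct_le_right (o x y : X) : gromovProduct dist o x y ≤ dist y o := by
  rw [gromovProduct_symm]
  exact gromovProduct_le_left o y x

theorem gromovProduct_nonneg (o x y : X) : 0 ≤ gromovProduct dist o x y := by
  have := dist_triangle x o y
  rw [dist_comm o y] at this
  unfold gromovProduct
  linarith

theorem gromovProduct_self (o x : X) : gromovProduct dist o x x = dist x o := by
  unfold gromovProduct
  rw [dist_self]
  ring

theorem gromovProduct_add (o x y : X) :
    gromovProduct dist o x y + gromovProduct dist x o y = dist x o := by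
  unfold gromovProduct
  rw [dist_comm o x, dist_comm y x, dist_comm o y]
  ring

theorem FourPoint.trans {δ : ℝ} (h : FourPoint X δ) {o x y z : X} {t : ℝ}
    (h1 : t ≤ gromovProduct dist o x z) (h2 : t ≤ gromovProduct dist o z y) :
    t - δ ≤ gromovProduct dist o x y := by
  have := h o x y z
  rw [gromovProduct_symm o y z] at this
  linarith [le_min h1 h2]

theorem FourPoint.nonneg {δ : ℝ} (h : FourPoint X δ) (o : X) : 0 ≤ δ := by
  have := h o o o o
  rw [min_self] at this
  linarith

/-- A chain of `N ≤ 2 ^ m` short steps outside the ball of radius `T` loses at most `m δ` in the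
Gromov product. -/
theorem FourPoint.chain {δ c T : ℝ} (h : FourPoint X δ) (o : X) (hc : 0 ≤ c) (m : ℕ) :
    ∀ (f : ℕ → X) (N : ℕ), N ≤ 2 ^ m → (∀ i ≤ N, T ≤ dist (f i) o) →
      (∀ i < N, dist (f i) (f (i + 1)) ≤ c) →
      T - c / 2 - m * δ ≤ gromovProduct dist o (f 0) (f N) := by
  induction m with
  | zero =>
    intro f N hN hT hs
    have hN' : N = 0 ∨ N = 1 := by
      simp at hN
      omega
    rcases hN' with rfl | rfl
    · have := hT 0 le_rfl
      rw [gromovProduct_self]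
      simp
      linarith
    · have h0 := hT 0 (by norm_num)
      have h1 := hT 1 le_rfl
      have h2 := hs 0 (by norm_num)
      simp only [gromovProduct, Nat.cast_zero, zero_add] at *
      linarith
  | succ m ih =>
    intro f N hN hT hs
    -- Cut the chain in two and join the halves at the cost of one `δ`, so the loss is logarithmic
    -- in the number of steps.
    have hM : min N (2 ^ m) ≤ N := min_le_left _ _
    have hδ := h.nonneg o
    have h1 := ih f (min N (2 ^ m)) (min_le_right _ _) (fun i hi => hT i (hi.trans hM))
      (fun i hi => hs i (hi.trans_le hM))
    have h2 := ih (fun i => f (min N (2 ^ m) + i)) (N - min N (2 ^ m))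
      (by rw [pow_succ] at hN; omega) (fun i hi => hT _ (by omega))
      (fun i hi => hs (min N (2 ^ m) + i) (by omega))
    simp only [add_zero, Nat.add_sub_cancel' hM] at h2
    have := h.trans h1 h2
    push_cast
    linarith

/-- On a path from `f 0` to `f k` there is a point close to the branch point of the tripod
spanned by `f 0`, `f k` and `y`. -/
theorem FourPoint.exists_near_branch {δ c : ℝ} (h : FourPoint X δ) (hc : 0 ≤ c) (m : ℕ)
    (f : ℕ → X) (k : ℕ) (hk : k ≤ 2 ^ m) (hs : ∀ i < k, dist (f i) (f (i + 1)) ≤ c) (y : X) :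
    ∃ i ≤ k, dist (f i) (f 0) ≤ gromovProduct dist (f 0) (f k) y ∧
      gromovProduct dist (f 0) (f k) y - (2 * c + (m + 1) * δ) ≤
        gromovProduct dist (f 0) (f i) y := by
  classical
  set t := gromovProduct dist (f 0) (f k) y with ht
  have hδ := h.nonneg y
  have ht0 : 0 ≤ t := gromovProduct_nonneg _ _ _
  have hex : ∃ i ≤ k, dist (f i) (f 0) ≤ t := ⟨0, Nat.zero_le _, by simpa using ht0⟩
  obtain ⟨i₀, hi₀, hi₀'⟩ := hex
  -- The last visit to the ball of radius `t` about `f 0`: from there on the path stays at distance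
  -- at least `t - c`, so `chain` applies to the remainder.
  set i := Nat.findGreatest (fun i => dist (f i) (f 0) ≤ t) k with hi
  have hik : i ≤ k := Nat.findGreatest_le k
  have hit : dist (f i) (f 0) ≤ t :=
    Nat.findGreatest_spec (P := fun i => dist (f i) (f 0) ≤ t) hi₀ hi₀'
  have hgt : ∀ j, i < j → j ≤ k → t ≤ dist (f j) (f 0) := fun j hj hjk =>
    (not_le.1 (Nat.findGreatest_is_greatest (P := fun i => dist (f i) (f 0) ≤ t) hj hjk)).le
  refine ⟨i, hik, hit, ?_⟩
  have hTi : t - c ≤ dist (f i) (f 0) := by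
    rcases hik.eq_or_lt with he | hl
    · have := gromovProduct_le_left (f 0) (f k) y
      rw [he]
      linarith
    · have h1 := hgt (i + 1) (Nat.lt_succ_self i) hl
      have h2 := hs i hl
      have h3 := dist_triangle (f (i + 1)) (f i) (f 0)
      rw [dist_comm (f (i + 1)) (f i)] at h3
      linarith
  have h1 := h.chain (f 0) hc (T := t - c) m (fun j => f (i + j)) (k - i) (by omega)
    (fun j hj => by
      rcases Nat.eq_zero_or_pos j with rfl | hj0
      · simpa using hTi
      · linarith [hgt (i + j) (by omega) (by omega)])
    (fun j hj => hs (i + j) (by omega))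
  simp only [add_zero, Nat.add_sub_cancel' hik] at h1
  have hm : 0 ≤ (m : ℝ) * δ := by positivity
  have h2 := h.trans (o := f 0) (x := f i) (y := y) (z := f k) (t := t - c - c / 2 - m * δ) h1
    (by linarith)
  linarith

/-- `f 0, …, f N` is a discrete quasi-geodesic with steps of length at most `c`. -/
structure IsQuasiGeodesic (L C c : ℝ) (f : ℕ → X) (N : ℕ) : Prop where
  step : ∀ i < N, dist (f i) (f (i + 1)) ≤ c
  lower : ∀ i j, i ≤ j → j ≤ N → (j : ℝ) - i ≤ L * dist (f i) (f j) + C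

theorem IsQuasiGeodesic.sub {L C c : ℝ} {f : ℕ → X} {N : ℕ} (h : IsQuasiGeodesic L C c f N)
    (a M : ℕ) (hM : a + M ≤ N) : IsQuasiGeodesic L C c (fun i => f (a + i)) M where
  step i hi := h.step (a + i) (by omega)
  lower i j hij hj := by
    have := h.lower (a + i) (a + j) (by omega) (by omega)
    push_cast at this
    linarith

theorem IsQuasiGeodesic.dist_le {L C c : ℝ} {f : ℕ → X} {N : ℕ}
    (h : IsQuasiGeodesic L C c f N) (i n : ℕ) (hn : i + n ≤ N) :
    dist (f i) (f (i + n)) ≤ c * n := by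
  induction n with
  | zero => simp
  | succ n ih =>
    have h1 := ih (by omega)
    have h2 := h.step (i + n) (by omega)
    have h3 := dist_triangle (f i) (f (i + n)) (f (i + n + 1))
    push_cast
    rw [← add_assoc]
    linarith

/-- The points of a quasi-geodesic of length `N` are within `O(log N)` of its ends' geodesic. -/
theorem IsQuasiGeodesic.log_bound {δ L C c : ℝ} (h : FourPoint X δ) (hL : 0 ≤ L) (hc : 0 ≤ c)
    {f : ℕ → X} {N : ℕ} (hf : IsQuasiGeodesic L C c f N) {k m : ℕ} (hk : k ≤ N)
    (hm : N ≤ 2 ^ m) :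
    gromovProduct dist (f k) (f 0) (f N) ≤
      (2 * c + (m + 1) * δ) + c * (L * (4 * (2 * c + (m + 1) * δ) + 2 * δ) + C) := by
  set E := 2 * c + (m + 1) * δ with hE
  have hδ := h.nonneg (f 0)
  obtain ⟨i, hik, hi1, hi2⟩ := h.exists_near_branch hc m f k (hk.trans hm)
    (fun i hi => hf.step i (by omega)) (f N)
  obtain ⟨j', hjk, hj1, hj2⟩ := h.exists_near_branch hc m (fun i => f (N - i)) (N - k)
    (by omega) (fun i hi => by
      have := hf.step (N - (i + 1)) (by omega)
      rwa [dist_comm, show N - (i + 1) + 1 = N - i by omega] at this) (f 0)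
  simp only [Nat.sub_zero, Nat.sub_sub_self hk] at hj1 hj2
  obtain ⟨j, hj, hkj, hjN⟩ : ∃ j, N - j' = j ∧ k ≤ j ∧ j ≤ N := ⟨N - j', rfl, by omega, by omega⟩
  rw [hj] at hj1 hj2
  have htt : gromovProduct dist (f 0) (f k) (f N) + gromovProduct dist (f N) (f k) (f 0) =
      dist (f 0) (f N) := by
    unfold gromovProduct
    rw [dist_comm (f N) (f 0)]
    ring
  set t := gromovProduct dist (f 0) (f k) (f N)
  set t' := gromovProduct dist (f N) (f k) (f 0)
  have e1 : gromovProduct dist (f 0) (f i) (f N) =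
      (dist (f i) (f 0) + dist (f 0) (f N) - dist (f i) (f N)) / 2 := by
    unfold gromovProduct; rw [dist_comm (f N) (f 0)]
  have e2 : gromovProduct dist (f N) (f j) (f 0) =
      (dist (f j) (f N) + dist (f 0) (f N) - dist (f j) (f 0)) / 2 := rfl
  have e3 : gromovProduct dist (f 0) (f j) (f N) =
      (dist (f j) (f 0) + dist (f 0) (f N) - dist (f j) (f N)) / 2 := by
    unfold gromovProduct; rw [dist_comm (f N) (f 0)]
  have htri := dist_triangle (f 0) (f j) (f N)
  rw [dist_comm (f 0) (f j)] at htri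
  have hE0 : 0 ≤ E := by positivity
  have h3 := h.trans (o := f 0) (x := f i) (y := f j) (z := f N) (t := t - E) hi2
    (by rw [gromovProduct_symm, e3]; linarith)
  have e4 : gromovProduct dist (f 0) (f i) (f j) =
      (dist (f i) (f 0) + dist (f j) (f 0) - dist (f i) (f j)) / 2 := rfl
  -- Both `f i` and `f j` lie near the branch point of the tripod on `f 0`, `f k`, `f N`. As `i ≤ k
  -- ≤ j`, the quasi-geodesic lower bound makes `k - i` small, so `f k` is near it too.
  have hij : dist (f i) (f j) ≤ 4 * E + 2 * δ := by linarith
  have hlow := hf.lower i j (hik.trans hkj) hjN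
  have h5 : dist (f i) (f k) ≤ c * (L * (4 * E + 2 * δ) + C) := by
    have h6 := hf.dist_le i (k - i) (by omega)
    rw [Nat.add_sub_cancel' hik] at h6
    refine h6.trans (mul_le_mul_of_nonneg_left ?_ hc)
    rw [Nat.cast_sub hik]
    have h7 : (k : ℝ) ≤ j := by exact_mod_cast hkj
    have h8 := mul_le_mul_of_nonneg_left hij hL
    linarith
  have e5 : gromovProduct dist (f k) (f 0) (f N) =
      (dist (f 0) (f k) + dist (f N) (f k) - dist (f 0) (f N)) / 2 := rfl
  have h9 := dist_triangle (f 0) (f i) (f k)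
  have h10 := dist_triangle (f N) (f i) (f k)
  rw [dist_comm (f 0) (f i)] at h9
  rw [dist_comm (f N) (f i)] at h10
  linarith

theorem exists_bound_of_two_pow_le (a b : ℝ) : ∃ M : ℕ, ∀ m : ℕ, (2 : ℝ) ^ m ≤ a * m + b → m ≤ M := by
  have h1 : Tendsto (fun n : ℕ => (n : ℝ) ^ 1 / (2 : ℝ) ^ n) atTop (𝓝 0) :=
    tendsto_pow_const_div_const_pow_of_one_lt 1 (by norm_num)
  have h2 : Tendsto (fun n : ℕ => (n : ℝ) ^ 0 / (2 : ℝ) ^ n) atTop (𝓝 0) :=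
    tendsto_pow_const_div_const_pow_of_one_lt 0 (by norm_num)
  have h3 : Tendsto (fun n : ℕ => a * ((n : ℝ) ^ 1 / (2 : ℝ) ^ n) + b * ((n : ℝ) ^ 0 / (2 : ℝ) ^ n))
      atTop (𝓝 0) := by
    simpa using (h1.const_mul a).add (h2.const_mul b)
  obtain ⟨M, hM⟩ := eventually_atTop.1 (h3.eventually (gt_mem_nhds one_pos))
  refine ⟨M, fun m hm => ?_⟩
  by_contra! hlt
  have h4 := hM m hlt.le
  have h5 : (0 : ℝ) < 2 ^ m := by positivity
  have h6 : a * ((m : ℝ) ^ 1 / (2 : ℝ) ^ m) + b * ((m : ℝ) ^ 0 / (2 : ℝ) ^ m) =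
      (a * m + b) / 2 ^ m := by ring
  rw [h6, div_lt_one h5] at h4
  linarith

/-- If `D` is bounded logarithmically in terms of itself then it is bounded. -/
theorem exists_bound_of_log_bound (a b p q : ℝ) (hp : 0 ≤ p) (hb : 0 ≤ b) :
    ∃ D₀ : ℝ, ∀ D : ℝ, 0 ≤ D →
      (∀ S m : ℕ, p * D + q ≤ S → 2 * S ≤ 2 ^ m → D ≤ b * m + a) →
        D ≤ D₀ := by
  obtain ⟨M, hM⟩ := exists_bound_of_two_pow_le (4 * p * b) (4 * (p * |a| + |q| + 1) + 4 * p * b + 1)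
  refine ⟨b * (M + 1 : ℕ) + a, fun D hD h => ?_⟩
  set S := ⌈p * D + q⌉₊ with hS
  have hS1 : p * D + q ≤ S := Nat.le_ceil _
  have hS2 : (S : ℝ) ≤ max (p * D + q) 0 + 1 := by
    rcases le_or_gt (p * D + q) 0 with h0 | h0
    · rw [hS, Nat.ceil_eq_zero.2 h0]
      have := le_max_right (p * D + q) 0
      push_cast
      linarith
    · have := (Nat.ceil_lt_add_one h0.le).le
      exact this.trans (by linarith [le_max_left (p * D + q) 0])
  -- Minimality of `m` gives `2 ^ (m - 1) < 2 * S`, which is at most linear in `D`, hence in `m`;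
  -- this bounds `m`.
  set m := Nat.clog 2 (2 * S)
  have hm := Nat.le_pow_clog (b := 2) one_lt_two (2 * S)
  have hD' := h S m hS1 hm
  refine hD'.trans ?_
  have hmM : m ≤ M + 1 := by
    by_contra! hlt
    have h1 : 2 ^ (m - 1) < 2 * S := by
      by_contra! h2
      have : m ≤ m - 1 := (Nat.clog_le_iff_le_pow one_lt_two).2 h2
      omega
    have h2 : (2 : ℝ) ^ (m - 1) ≤ 2 * S := by exact_mod_cast h1.le
    have hS3 : (S : ℝ) ≤ p * D + |q| + 1 := by
      refine hS2.trans ?_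
      have : max (p * D + q) 0 ≤ p * D + |q| :=
        max_le (by linarith [le_abs_self q]) (by positivity)
      linarith
    have h3 := hM (m - 1) (by
      have h4 : p * D ≤ p * (b * m + |a|) :=
        mul_le_mul_of_nonneg_left (by linarith [le_abs_self a]) hp
      have h5 : ((m - 1 : ℕ) : ℝ) = m - 1 := by
        rw [Nat.cast_sub (by omega)]; simp
      have h6 : 0 ≤ p * b * m := by positivity
      have h7 : 0 ≤ p * |a| := by positivity
      have h8 := abs_nonneg q
      rw [h5]
      nlinarith)
    omega
  have : (m : ℝ) ≤ (M + 1 : ℕ) := by exact_mod_cast hmM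
  linarith [mul_le_mul_of_nonneg_left this hb]

/-- Stability of quasi-geodesics: they are rulers up to a uniform error. -/
theorem exists_quasiGeodesic_bound {δ L C c : ℝ} (h : FourPoint X δ) (hL : 0 < L) (hc : 0 ≤ c) :
    ∃ D₀ : ℝ, ∀ (f : ℕ → X) (N : ℕ), IsQuasiGeodesic L C c f N →
      ∀ k ≤ N, gromovProduct dist (f k) (f 0) (f N) ≤ D₀ := by
  rcases isEmpty_or_nonempty X with hX | ⟨⟨x₀⟩⟩
  · exact ⟨0, fun f => (hX.false (f 0)).elim⟩
  have hδ := h.nonneg x₀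
  -- The bound of `log_bound`, sorted by powers of `m`, plus `2 * δ`. The slope `2 * L` and shift
  -- `C` ensure that points `S` indices apart are at distance at least `2 * D`.
  obtain ⟨D₀, hD₀⟩ := exists_bound_of_log_bound
    (2 * c + δ + c * (L * (4 * (2 * c + δ) + 2 * δ) + C) + 2 * δ) (δ + c * (L * (4 * δ)))
    (2 * L) C (by positivity) (by positivity)
  refine ⟨D₀, fun f N hf k₀ hk₀ => ?_⟩
  set s : Finset (ℕ × ℕ × ℕ) :=
    (Finset.range (N + 1) ×ˢ Finset.range (N + 1) ×ˢ Finset.range (N + 1)).filter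
      (fun p => p.1 ≤ p.2.1 ∧ p.2.1 ≤ p.2.2) with hs
  have hmem : ∀ i k j, (i, k, j) ∈ s ↔ i ≤ k ∧ k ≤ j ∧ j ≤ N := by
    intro i k j
    simp only [hs, Finset.mem_filter, Finset.mem_product, Finset.mem_range]
    omega
  -- Take the worst triple over all subpaths. Its maximality allows the ends to be pulled in to
  -- within `S` of `k` while losing only `2 * δ`, and `log_bound` on this short window bounds `D` by
  -- its own logarithm.
  obtain ⟨⟨i, k, j⟩, hikj, hmax⟩ := s.exists_max_image
    (fun p => gromovProduct dist (f p.2.1) (f p.1) (f p.2.2))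
    ⟨(0, k₀, N), (hmem _ _ _).2 ⟨Nat.zero_le _, hk₀, le_rfl⟩⟩
  obtain ⟨hik, hkj, hjN⟩ := (hmem _ _ _).1 hikj
  simp only at hmax
  refine (hmax (0, k₀, N) ((hmem _ _ _).2 ⟨Nat.zero_le _, hk₀, le_rfl⟩)).trans ?_
  set D := gromovProduct dist (f k) (f i) (f j) with hD
  refine hD₀ D (gromovProduct_nonneg _ _ _) fun S m hS hm => ?_
  have hfar : ∀ a b : ℕ, a ≤ b → b ≤ N → b - a = S → 2 * D ≤ dist (f a) (f b) := by
    intro a b hab hb hS'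
    have := hf.lower a b hab hb
    rw [← Nat.cast_sub hab, hS'] at this
    exact le_of_mul_le_mul_left (by linarith) hL
  obtain ⟨i', hii', hik', hi'S, hi'⟩ : ∃ i', i ≤ i' ∧ i' ≤ k ∧ k ≤ i' + S ∧
      D ≤ gromovProduct dist (f k) (f i') (f i) := by
    rcases le_or_gt (k - S) i with hle | hlt
    · refine ⟨i, le_rfl, hik, by omega, ?_⟩
      rw [gromovProduct_self]
      exact gromovProduct_le_left _ _ _
    · refine ⟨k - S, hlt.le, by omega, by omega, ?_⟩
      have h1 := hfar (k - S) k (by omega) (by omega) (by omega)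
      -- The product based at `f (k - S)` is at most `D`, so the complementary one based at `f k` is
      -- at least `2 * D - D`.
      have h2 := hmax (i, k - S, k) ((hmem _ _ _).2 ⟨hlt.le, by omega, by omega⟩)
      have h3 := gromovProduct_add (f k) (f (k - S)) (f i)
      rw [gromovProduct_symm (f (k - S))] at h3
      linarith
  obtain ⟨j', hjj', hkj', hj'S, hj'⟩ : ∃ j', j' ≤ j ∧ k ≤ j' ∧ j' ≤ k + S ∧
      D ≤ gromovProduct dist (f k) (f j) (f j') := by
    rcases le_or_gt j (k + S) with hle | hlt
    · refine ⟨j, le_rfl, hkj, by omega, ?_⟩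
      rw [gromovProduct_self]
      exact gromovProduct_le_right _ _ _
    · refine ⟨k + S, hlt.le, by omega, by omega, ?_⟩
      have h1 := hfar k (k + S) (by omega) (by omega) (by omega)
      have h2 := hmax (k, k + S, j) ((hmem _ _ _).2 ⟨by omega, by omega, by omega⟩)
      have h3 := gromovProduct_add (f k) (f (k + S)) (f j)
      rw [dist_comm (f (k + S))] at h3
      rw [gromovProduct_symm]
      linarith
  have h1 := h.trans (o := f k) (t := D - δ) (x := f i') (y := f j') (z := f j)
    (h.trans hi' hD.le) (by linarith)
  have h2 := (hf.sub i' (j' - i') (by omega)).log_bound h hL.le hc (k := k - i') (m := m)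
    (by omega) (by omega)
  simp only [add_zero, Nat.add_sub_cancel' hik', Nat.add_sub_cancel' (hik'.trans hkj')] at h2
  nlinarith
end Morse

/-! ### Properness and rough geodesicity of the metric -/

section CayleyGraph

variable {Γ : Type*} [Group Γ]

theorem mulCayley_connected {S : Set Γ} (hS : Subgroup.closure S = ⊤) :
    (SimpleGraph.mulCayley S).Connected := by
  have key : ∀ x y : Γ, x⁻¹ * y ∈ S ∨ y⁻¹ * x ∈ S → (SimpleGraph.mulCayley S).Reachable x y := by
    intro x y h
    by_cases hxy : x = y
    · rw [hxy]
    · exact ((SimpleGraph.mulCayley_adj S x y).2 ⟨hxy, h⟩).reachable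
  have h1 : ∀ g : Γ, (SimpleGraph.mulCayley S).Reachable 1 g := by
    intro g
    have hg : g ∈ Subgroup.closure S := hS ▸ Subgroup.mem_top g
    induction hg using Subgroup.closure_induction_right with
    | one => exact SimpleGraph.Reachable.refl 1
    | mul_right x _ y hy ih => exact ih.trans (key _ _ (Or.inl (by simpa using hy)))
    | mul_inv_cancel x _ y hy ih => exact ih.trans (key _ _ (Or.inr (by simpa using hy)))
  exact { preconnected := fun x y => (h1 x).symm.trans (h1 y), nonempty := ⟨1⟩ }

theorem finite_wordDist_le {S : Set Γ} (hS : IsFiniteGenerating S) (r : ℝ) :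
    {g : Γ | wordDist S g 1 ≤ r}.Finite := by
  have hn : ∀ n : ℕ, {g : Γ | ∃ p : (SimpleGraph.mulCayley S).Walk g 1, p.length = n}.Finite := by
    intro n
    induction n with
    | zero =>
      refine (Set.finite_singleton (1 : Γ)).subset ?_
      rintro g ⟨p, hp⟩
      exact SimpleGraph.Walk.eq_of_length_eq_zero hp
    | succ n ih =>
      refine ((ih.biUnion fun v _ => (hS.1.image fun s => v * s).union
        (hS.1.image fun s => v * s⁻¹))).subset ?_
      rintro g ⟨p, hp⟩
      cases p with
      | nil => simp at hp
      | @cons _ v _ hadj q =>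
        simp only [Set.mem_iUnion]
        refine ⟨v, ⟨q, by simpa using hp⟩, ?_⟩
        rcases ((SimpleGraph.mulCayley_adj S g v).1 hadj).2 with h | h
        · exact Or.inr ⟨_, h, by group⟩
        · exact Or.inl ⟨_, h, by group⟩
  refine ((Set.finite_Iic ⌊r⌋₊).biUnion fun n _ => hn n).subset ?_
  intro g hg
  obtain ⟨p, hp⟩ := (mulCayley_connected hS.2).exists_walk_length_eq_dist g 1
  simp only [Set.mem_iUnion]
  exact ⟨_, Nat.le_floor hg, p, hp⟩

variable [MetricSpace Γ]

theorem MetricInClassD.finite_len_le (hd : MetricInClassD Γ) (r : ℝ) :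
    {g : Γ | len g ≤ r}.Finite := by
  obtain ⟨S, hS, L, C, hL, -, hLC⟩ := hd.quasiIsometric
  refine (finite_wordDist_le hS (L * (r + C))).subset fun g hg => ?_
  have h1 := (hLC g 1).1
  have hg' : dist g 1 ≤ r := hg
  have h2 : 1 / L * wordDist S g 1 ≤ r + C := by linarith
  rw [one_div, inv_mul_le_iff₀ (by linarith)] at h2
  exact h2

/-- Left translation carries any basepoint to `1`, so one constant serves everywhere. -/
theorem MetricInClassD.exists_fourPoint (hd : MetricInClassD Γ) : ∃ δ : ℝ, FourPoint Γ δ := by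
  obtain ⟨δ, hδ⟩ := hyperbolic_basepoint hd.hyperbolic 1
  refine ⟨δ, fun o x y z => ?_⟩
  have key : ∀ a b : Γ, gromovProduct dist 1 (o⁻¹ * a) (o⁻¹ * b) = gromovProduct dist o a b := by
    intro a b
    unfold gromovProduct
    rw [hd.left_invariant, ← hd.left_invariant o (o⁻¹ * a) 1, ← hd.left_invariant o (o⁻¹ * b) 1]
    simp
  simpa only [key] using hδ (o⁻¹ * x) (o⁻¹ * y) (o⁻¹ * z)

/-- Any two points are joined by a quasi-geodesic with uniform constants. -/
theorem MetricInClassD.exists_quasiGeodesic (hd : MetricInClassD Γ) :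
    ∃ L C c : ℝ, 0 < L ∧ 0 ≤ c ∧ ∀ x y : Γ, ∃ (f : ℕ → Γ) (N : ℕ),
      f 0 = x ∧ f N = y ∧ IsQuasiGeodesic L C c f N := by
  obtain ⟨S, hS, L, C, hL, hC, hLC⟩ := hd.quasiIsometric
  have hconn := mulCayley_connected hS.2
  refine ⟨L, L * C, L + C, by linarith, by linarith, fun x y => ?_⟩
  obtain ⟨p, hp⟩ := hconn.exists_walk_length_eq_dist x y
  have hstep : ∀ i n, i + n ≤ p.length →
      (SimpleGraph.mulCayley S).dist (p.getVert i) (p.getVert (i + n)) ≤ n := by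
    intro i n
    induction n with
    | zero => simp
    | succ n ih =>
      intro hn
      have h1 := ih (by omega)
      have h2 := SimpleGraph.dist_eq_one_iff_adj.2 (p.adj_getVert_succ (i := i + n) (by omega))
      have h3 := hconn.dist_triangle (u := p.getVert i) (v := p.getVert (i + n))
        (w := p.getVert (i + n + 1))
      rw [← add_assoc]
      omega
  refine ⟨p.getVert, p.length, p.getVert_zero, p.getVert_length, fun i hi => ?_,
    fun i j hij hj => ?_⟩
  · have h1 := (hLC (p.getVert i) (p.getVert (i + 1))).2
    rw [wordDist, SimpleGraph.dist_eq_one_iff_adj.2 (p.adj_getVert_succ hi)] at h1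
    simpa using h1
  · have h1 := hstep 0 i (by omega)
    have h2 := hstep j (p.length - j) (by omega)
    rw [Nat.add_sub_cancel' hj, p.getVert_length] at h2
    rw [zero_add, p.getVert_zero] at h1
    have h3 := hconn.dist_triangle (u := x) (v := p.getVert i) (w := p.getVert j)
    have h4 := hconn.dist_triangle (u := x) (v := p.getVert j) (w := y)
    have h5 : j ≤ i + (SimpleGraph.mulCayley S).dist (p.getVert i) (p.getVert j) := by omega
    have h6 : (j : ℝ) ≤ i + wordDist S (p.getVert i) (p.getVert j) := by
      unfold wordDist
      exact_mod_cast h5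
    have h7 := (hLC (p.getVert i) (p.getVert j)).1
    have h8 : 1 / L * wordDist S (p.getVert i) (p.getVert j) ≤
      dist (p.getVert i) (p.getVert j) + C := by linarith
    rw [one_div, inv_mul_le_iff₀ (by linarith)] at h8
    linarith

/-- The metric is roughly geodesic: there are points at any prescribed distance from `1` in the
direction of `z`. -/
theorem MetricInClassD.exists_point_toward (hd : MetricInClassD Γ) :
    ∃ C : ℝ, 0 ≤ C ∧ ∀ (z : Γ) (t : ℝ), 0 ≤ t → t ≤ len z →
      ∃ x : Γ, t ≤ len x ∧ len x ≤ t + C ∧ t - C ≤ gromovProduct dist 1 x z := by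
  obtain ⟨δ, hδ⟩ := hd.exists_fourPoint
  obtain ⟨L, C, c, hL, hc, hqg⟩ := hd.exists_quasiGeodesic
  obtain ⟨D, hD⟩ := exists_quasiGeodesic_bound (C := C) hδ hL hc
  refine ⟨max c D, hc.trans (le_max_left _ _), fun z t ht htz => ?_⟩
  obtain ⟨f, N, h0, hN, hf⟩ := hqg 1 z
  classical
  have hex : ∃ k, t ≤ dist (f k) 1 := ⟨N, by rw [hN]; exact htz⟩
  -- The first exit from the ball of radius `t` overshoots by at most one step `c`; stability bounds
  -- `(1, z)` at `f k` by `D`, hence `(f k, z)` from below.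
  set k := Nat.find hex with hk
  have hkt : t ≤ dist (f k) 1 := Nat.find_spec hex
  have hkN : k ≤ N := Nat.find_min' hex (by rw [hN]; exact htz)
  have h1 : dist (f k) 1 ≤ t + c := by
    rcases Nat.eq_zero_or_pos k with h | h
    · rw [h, h0, dist_self]
      linarith
    · have h2 := not_le.1 (Nat.find_min hex (m := k - 1) (by omega))
      have h3 := hf.step (k - 1) (by omega)
      rw [Nat.sub_add_cancel h, dist_comm] at h3
      linarith [dist_triangle (f k) (f (k - 1)) 1]
  refine ⟨f k, hkt, h1.trans (by linarith [le_max_left c D]), ?_⟩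
  have h2 := hD f N hf k hkN
  rw [h0, hN] at h2
  have h3 := gromovProduct_add 1 (f k) z
  linarith [le_max_right c D]

end CayleyGraph

/-! ### Groups fixing a point at infinity, and general position -/

section NonElementary

/-- A function on a group which is a homomorphism up to a bounded error and whose sublevel sets
are finite exists only on virtually cyclic groups. -/
theorem exists_cyclic_finiteIndex_of_quasimorphism {Γ : Type*} [Group Γ] {D : ℝ} (β : Γ → ℝ)
    (hβ : ∀ f g : Γ, |β (f * g) - β f - β g| ≤ D) (hfin : ∀ K : ℝ, {f : Γ | |β f| ≤ K}.Finite) :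
    ∃ H : Subgroup Γ, IsCyclic H ∧ H.FiniteIndex := by
  have hD : 0 ≤ D := (abs_nonneg _).trans (hβ 1 1)
  by_cases hb : ∀ g, |β g| ≤ 3 * D + 1
  · have hΓ : Finite Γ := Set.finite_univ_iff.1 ((hfin _).subset fun g _ => hb g)
    exact ⟨⊥, inferInstance, inferInstance⟩
  push Not at hb
  obtain ⟨g, hg⟩ := hb
  have h1 := abs_le.1 (hβ 1 1)
  have h2 := abs_le.1 (hβ g g⁻¹)
  rw [mul_one] at h1
  rw [mul_inv_cancel] at h2
  -- Since `β g⁻¹` is within `2 * D` of `-β g`, multiplying `h` by `g` or `g⁻¹`, according to sign,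
  -- lowers `|β h| > B` by at least `1`. So every coset of `⟨g⟩` meets the finite set `|β| ≤ B`.
  set B := |β g| + 3 * D + 1 with hB
  have key : ∀ n : ℕ, ∀ h : Γ, |β h| ≤ n → ∃ k : ℤ, |β (h * g ^ k)| ≤ B := by
    intro n
    induction n with
    | zero =>
      intro h hh
      refine ⟨0, ?_⟩
      have := abs_nonneg (β g)
      simp at hh ⊢
      rw [hh, abs_zero]
      positivity
    | succ n ih =>
      intro h hh
      by_cases hle : |β h| ≤ B
      · exact ⟨0, by simpa using hle⟩
      suffices hs : ∃ e : ℤ, |β (h * g ^ e)| ≤ |β h| - 1 by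
        obtain ⟨e, he⟩ := hs
        obtain ⟨k, hk⟩ := ih (h * g ^ e) (by push_cast at hh; linarith)
        exact ⟨e + k, by rwa [zpow_add, ← mul_assoc]⟩
      have h3 := abs_le.1 (hβ h g)
      have h4 := abs_le.1 (hβ h g⁻¹)
      push Not at hle
      have e1 : g ^ (1 : ℤ) = g := zpow_one g
      have e2 : g ^ (-1 : ℤ) = g⁻¹ := zpow_neg_one g
      rcases abs_cases (β h) with ⟨a1, a2⟩ | ⟨a1, a2⟩ <;>
      rcases abs_cases (β g) with ⟨b1, b2⟩ | ⟨b1, b2⟩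
      · exact ⟨-1, by rw [e2, abs_le]; constructor <;> linarith⟩
      · exact ⟨1, by rw [e1, abs_le]; constructor <;> linarith⟩
      · exact ⟨1, by rw [e1, abs_le]; constructor <;> linarith⟩
      · exact ⟨-1, by rw [e2, abs_le]; constructor <;> linarith⟩
  refine ⟨Subgroup.zpowers g, inferInstance, ?_⟩
  have : Finite {f : Γ | |β f| ≤ B} := hfin B
  have hq : Finite (Γ ⧸ Subgroup.zpowers g) := by
    refine Finite.of_surjective (fun f : {f : Γ | |β f| ≤ B} => (f.1 : Γ ⧸ Subgroup.zpowers g)) ?_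
    intro q
    obtain ⟨h, rfl⟩ := QuotientGroup.mk_surjective q
    obtain ⟨n, hn⟩ := exists_nat_ge |β h|
    obtain ⟨k, hk⟩ := key n h hn
    refine ⟨⟨h * g ^ k, hk⟩, ?_⟩
    rw [QuotientGroup.eq]
    exact ⟨-k, by simp⟩
  exact Subgroup.finiteIndex_of_finite_quotient

theorem exists_tendsto_ultrafilter {ι : Type*} (U : Ultrafilter ι) (a : ι → ℝ) (M : ℝ)
    (ha : ∀ i, |a i| ≤ M) : ∃ b : ℝ, Tendsto a U (𝓝 b) := by
  obtain ⟨b, -, hb⟩ := (isCompact_Icc (a := -M) (b := M)).ultrafilter_le_nhds (U.map a) (by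
    rw [le_principal_iff]
    exact Filter.mem_map.2 (Eventually.of_forall fun i => abs_le.1 (ha i)))
  exact ⟨b, hb⟩

variable {Γ : Type*} [Group Γ] [MetricSpace Γ]

theorem MetricInClassD.len_mul (hd : MetricInClassD Γ) (f g : Γ) :
    len (f * g) = dist g f⁻¹ := by
  rw [len, ← hd.left_invariant f g f⁻¹, mul_inv_cancel]

theorem MetricInClassD.len_inv (hd : MetricInClassD Γ) (f : Γ) : len f⁻¹ = len f := by
  rw [len, ← hd.left_invariant f f⁻¹ 1, mul_inv_cancel, mul_one, dist_comm, len]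

theorem MetricInClassD.gromovProduct_mul (hd : MetricInClassD Γ) (f x y : Γ) :
    gromovProduct dist 1 (f * x) (f * y) =
      gromovProduct dist 1 x y - ((len x - len (f * x)) + (len y - len (f * y))) / 2 := by
  unfold gromovProduct len
  rw [hd.left_invariant]
  ring

theorem MetricInClassD.abs_len_sub_len_mul_le (hd : MetricInClassD Γ) (f x : Γ) :
    |len x - len (f * x)| ≤ len f := by
  rw [hd.len_mul, ← hd.len_inv f, len, len]
  have h1 := dist_triangle x f⁻¹ 1
  have h2 := dist_triangle x 1 f⁻¹
  rw [dist_comm 1] at h2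
  rw [abs_le]
  constructor <;> linarith

/-- The approximate Busemann functions of points in the same direction almost agree. -/
theorem MetricInClassD.abs_busemann_sub_le (hd : MetricInClassD Γ) {δ : ℝ} (hδ : FourPoint Γ δ)
    (f u w : Γ) (h : len f ≤ gromovProduct dist 1 u w) :
    |(len u - len (f * u)) - (len w - len (f * w))| ≤ 2 * δ := by
  have key : ∀ x y : Γ, len f ≤ gromovProduct dist 1 x y →
      (len x - len (f * x)) - (len y - len (f * y)) ≤ 2 * δ := by
    intro x y hxy
    -- Since `(f⁻¹, x) ≤ |f| ≤ (x, y)`, the four-point inequality transfers this product from `x` to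
    -- `y`.
    have e : ∀ z, len z - len (f * z) = 2 * gromovProduct dist 1 f⁻¹ z - len f := by
      intro z
      rw [hd.len_mul, ← hd.len_inv f]
      unfold gromovProduct len
      rw [dist_comm f⁻¹ z]
      ring
    have h1 := gromovProduct_le_left 1 f⁻¹ x
    have h2 : dist f⁻¹ 1 = len f := hd.len_inv f
    have h3 := hδ.trans (o := 1) (x := f⁻¹) (z := x) (y := y) le_rfl (by linarith)
    rw [e, e]
    linarith
  rw [abs_le]
  have h1 := key u w h
  have h2 := key w u (by rwa [gromovProduct_symm])
  constructor <;> linarith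

/-- Such `f` nearly preserve both the direction of `u` and its horospheres. Hence finitely many of
them move a point `x` far out in that direction by an amount independent of how many there are:
their conjugates `x⁻¹ f x` lie in a fixed finite ball, which bounds their number. -/
theorem MetricInClassD.finite_busemann_le (hd : MetricInClassD Γ) {δ : ℝ} (hδ : FourPoint Γ δ)
    {ι : Type*} (U : Filter ι) [U.NeBot] (u : ι → Γ) (hlen : Tendsto (fun i => len (u i)) U atTop)
    (hu : ∀ f : Γ, Tendsto (fun i => gromovProduct dist 1 (u i) (f * u i)) U atTop) (K : ℝ) :
    {f : Γ | ∀ᶠ i in U, |len (u i) - len (f * u i)| ≤ K}.Finite := by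
  obtain ⟨C, hC, htoward⟩ := hd.exists_point_toward
  have hδ0 := hδ.nonneg 1
  have hball := hd.finite_len_le (4 * C + 3 * (K + 2 * δ) + 4 * δ)
  by_contra hinf
  obtain ⟨T, hT, hcard⟩ := Set.Infinite.exists_subset_card_eq hinf (hball.toFinset.card + 1)
  obtain ⟨m, hm⟩ : ∃ m : ℝ, ∀ f ∈ T, len f ≤ m :=
    ⟨∑ f ∈ T, len f, fun f hf => Finset.single_le_sum (f := len) (fun g _ => dist_nonneg) hf⟩
  have hev : ∀ᶠ i in U, (∀ f ∈ T, |len (u i) - len (f * u i)| ≤ K ∧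
      |m| + C ≤ gromovProduct dist 1 (u i) (f * u i)) ∧ |m| + C ≤ len (u i) :=
    ((eventually_all_finset T).2 fun f hf =>
      (show ∀ᶠ i in U, |len (u i) - len (f * u i)| ≤ K from hT hf).and
        ((hu f).eventually_ge_atTop _)).and (hlen.eventually_ge_atTop _)
  obtain ⟨i, hi, hli⟩ := hev.exists
  obtain ⟨x, hx1, hx2, hx3⟩ := htoward (u i) (|m| + C) (by positivity) hli
  have hmaps : ∀ f ∈ T, x⁻¹ * f * x ∈ hball.toFinset := by
    intro f hf
    obtain ⟨h1, h2⟩ := hi f hf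
    have h3 := hd.abs_busemann_sub_le hδ f x (u i) (by linarith [hm f hf, le_abs_self m])
    have h4 := hd.gromovProduct_mul f x (u i)
    rw [abs_le] at h1 h3
    have hK : 0 ≤ K := by linarith
    have h5 := hδ.trans (o := 1) (x := x) (z := u i) (y := f * u i) (t := |m|) (by linarith)
      (by linarith)
    have h6 := hδ.trans (o := 1) (x := x) (z := f * u i) (y := f * x)
      (t := |m| - (K + 2 * δ) - δ) (by linarith)
      (by rw [gromovProduct_symm]; linarith)
    have h7 : gromovProduct dist 1 x (f * x) = (len x + len (f * x) - dist x (f * x)) / 2 := rfl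
    rw [Set.Finite.mem_toFinset, Set.mem_ofPred_eq, mul_assoc, hd.len_mul, inv_inv, dist_comm]
    linarith
  have := Finset.card_le_card_of_injOn (fun f => x⁻¹ * f * x) hmaps (fun f _ g _ h => by simpa using h)
  omega

/-- A group with a metric of class `𝒟` that fixes a point at infinity is virtually cyclic. -/
theorem MetricInClassD.exists_cyclic_finiteIndex (hd : MetricInClassD Γ) (u : ℕ → Γ)
    (hlen : Tendsto (fun i => len (u i)) atTop atTop)
    (hu : ∀ f : Γ, Tendsto (fun i => gromovProduct dist 1 (u i) (f * u i)) atTop atTop) :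
    ∃ H : Subgroup Γ, IsCyclic H ∧ H.FiniteIndex := by
  obtain ⟨δ, hδ⟩ := hd.exists_fourPoint
  -- The Busemann differences are bounded for each `f` but need not converge; an ultrafilter gives
  -- limits for all `f` at once.
  set U : Ultrafilter ℕ := Ultrafilter.of atTop
  have hU : (U : Filter ℕ) ≤ atTop := Ultrafilter.of_le atTop
  have hex : ∀ f : Γ, ∃ b : ℝ, Tendsto (fun i => len (u i) - len (f * u i)) U (𝓝 b) := fun f =>
    exists_tendsto_ultrafilter U _ (len f) fun i => hd.abs_len_sub_len_mul_le f (u i)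
  choose β hβ using hex
  refine exists_cyclic_finiteIndex_of_quasimorphism (D := 2 * δ) β (fun f g => ?_) fun K => ?_
  · refine le_of_tendsto (((hβ (f * g)).sub (hβ f)).sub (hβ g)).abs ?_
    -- The defect compares the Busemann differences of `f` at `u i` and at `g * u i`, which point in
    -- the same direction.
    filter_upwards [hU ((hu g).eventually_ge_atTop (len f))] with i hi
    have h1 := hd.abs_busemann_sub_le hδ f (u i) (g * u i) hi
    rw [abs_sub_comm] at h1
    rw [mul_assoc]
    refine le_of_eq_of_le ?_ h1
    congr 1
    ring
  · refine (hd.finite_busemann_le hδ (U : Filter ℕ) u (hlen.mono_left hU)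
      (fun f => (hu f).mono_left hU) (K + 1)).subset fun f hf => ?_
    have hf' : |β f| < K + 1 := lt_of_le_of_lt hf (by linarith)
    filter_upwards [(hβ f).abs.eventually (gt_mem_nhds hf')] with i hi using hi.le

/-- In the non-elementary case two elements can be put in general position by translating one of
them by an element of a fixed finite set. -/
theorem MetricInClassD.exists_finite_gromovProduct_le (hd : MetricInClassD Γ)
    (hne : IsNonElementary Γ) :
    ∃ M C : ℝ, 0 ≤ M ∧ 0 ≤ C ∧ ∀ u v : Γ, ∃ f : Γ, len f ≤ M ∧ gromovProduct dist 1 u (f * v) ≤ C := by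
  obtain ⟨δ, hδ⟩ := hd.exists_fourPoint
  by_contra! hcon
  -- Both `u n` and `f * u n` have large product with `f * v n`: the first by choice, the second by
  -- translating the case `f = 1`. So each `f` fixes the direction of `u`.
  have hcon' : ∀ n : ℕ, ∃ u v : Γ, ∀ f : Γ, len f ≤ n → (n : ℝ) < gromovProduct dist 1 u (f * v) :=
    fun n => hcon n n n.cast_nonneg n.cast_nonneg
  choose u v huv using hcon'
  have hone : ∀ n : ℕ, (n : ℝ) < gromovProduct dist 1 (u n) (v n) := fun n => by
    simpa using huv n 1 (by simp [len])
  refine hne (hd.exists_cyclic_finiteIndex u ?_ fun f => ?_)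
  · exact tendsto_atTop_mono
      (fun n => (hone n).le.trans (gromovProduct_le_left 1 (u n) (v n))) tendsto_natCast_atTop_atTop
  · refine tendsto_atTop_mono' _ (f₁ := fun n : ℕ => (n : ℝ) - len f - δ) ?_ ?_
    · filter_upwards [eventually_ge_atTop ⌈len f⌉₊] with n hn
      have h1 := huv n f ((Nat.le_ceil _).trans (by exact_mod_cast hn))
      have h2 := hone n
      have h3 := hd.gromovProduct_mul f (v n) (u n)
      have h4 := abs_le.1 (hd.abs_len_sub_len_mul_le f (v n))
      have h5 := abs_le.1 (hd.abs_len_sub_len_mul_le f (u n))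
      rw [gromovProduct_symm 1 (v n)] at h3
      have h6 : 0 ≤ len f := dist_nonneg
      exact hδ.trans (z := f * v n) (by linarith) (by linarith)
    · simpa only [sub_eq_add_neg, add_assoc] using
        tendsto_atTop_add_const_right atTop (-len f + -δ) tendsto_natCast_atTop_atTop

end NonElementary

/-! ### From group elements to balls in the boundary -/

section Covering

variable {Γ : Type*} [Group Γ] [MetricSpace Γ]

/-- Aim at one far term of the sequence; all later terms agree with it beyond `t`. -/
theorem MetricInClassD.exists_point_toward_boundary (hd : MetricInClassD Γ) :
    ∃ C : ℝ, 0 ≤ C ∧ ∀ s : ℕ → Γ, TendsToInfinity 1 s → ∀ t : ℝ, 0 ≤ t →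
      ∃ x : Γ, t ≤ len x ∧ len x ≤ t + C ∧ ∀ᶠ j in atTop, t - C ≤ gromovProduct dist 1 x (s j) := by
  obtain ⟨C, hC, htoward⟩ := hd.exists_point_toward
  obtain ⟨δ, hδ⟩ := hd.exists_fourPoint
  have hδ0 := hδ.nonneg 1
  refine ⟨C + δ, by positivity, fun s hs t ht => ?_⟩
  obtain ⟨N, hN⟩ := eventually_atTop_prod_self'.1 (hs.eventually_ge_atTop t)
  obtain ⟨x, hx1, hx2, hx3⟩ := htoward (s N) t ht
    ((hN N le_rfl N le_rfl).trans (gromovProduct_le_left _ _ _))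
  refine ⟨x, hx1, by linarith, ?_⟩
  filter_upwards [eventually_ge_atTop N] with j hj
  have := hδ.trans hx3 (by linarith [hN N le_rfl j hj])
  linarith

/-- For any two boundary points there is a group element of length close to `R` which points
towards the first one up to distance `R / 2`, and whose inverse points towards the second one. -/
theorem MetricInClassD.exists_element_toward (hd : MetricInClassD Γ) (hne : IsNonElementary Γ) :
    ∃ C : ℝ, 0 ≤ C ∧ ∀ s s' : ℕ → Γ, TendsToInfinity 1 s → TendsToInfinity 1 s' →
      ∀ R : ℝ, 0 < R → ∃ g : Γ, R - C ≤ len g ∧ len g ≤ R + C ∧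
        (∀ᶠ j in atTop, R / 2 - C ≤ gromovProduct dist 1 g (s j)) ∧
        ∀ᶠ j in atTop, R / 2 - C ≤ gromovProduct dist 1 g⁻¹ (s' j) := by
  obtain ⟨C, hC, htoward⟩ := hd.exists_point_toward_boundary
  obtain ⟨δ, hδ⟩ := hd.exists_fourPoint
  obtain ⟨M, C', hM, hC', hgen⟩ := hd.exists_finite_gromovProduct_le hne
  have hδ0 := hδ.nonneg 1
  refine ⟨2 * C + 2 * M + 2 * C' + δ, by positivity, fun s s' hs hs' R hR => ?_⟩
  obtain ⟨x, hx1, hx2, hx3⟩ := htoward s hs (R / 2) (by positivity)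
  obtain ⟨y, hy1, hy2, hy3⟩ := htoward s' hs' (R / 2) (by positivity)
  obtain ⟨f, hf, hfC⟩ := hgen x⁻¹ y⁻¹
  have hg : len (x * (f * y⁻¹)) = dist x⁻¹ (f * y⁻¹) := by
    rw [hd.len_mul, dist_comm]
  have hprod : gromovProduct dist 1 x⁻¹ (f * y⁻¹) =
      (len x⁻¹ + len (f * y⁻¹) - dist x⁻¹ (f * y⁻¹)) / 2 := rfl
  have hnonneg := gromovProduct_nonneg 1 x⁻¹ (f * y⁻¹)
  have hfy := abs_le.1 (hd.abs_len_sub_len_mul_le f y⁻¹)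
  rw [hd.len_inv y] at hfy
  rw [hd.len_inv x] at hprod
  -- With `g = x * (f * y⁻¹)`, the distance from `g` to `x` is `|f y⁻¹|`, about `R / 2`, so `(g, x)`
  -- is about `R / 2`; the same holds for `g⁻¹ = y (x f)⁻¹` and `y`.
  have hgx : gromovProduct dist 1 (x * (f * y⁻¹)) x =
      (len (x * (f * y⁻¹)) + len x - len (f * y⁻¹)) / 2 := by
    unfold gromovProduct
    have := hd.left_invariant x (f * y⁻¹) 1
    rw [mul_one] at this
    rw [this]
    rfl
  have hgy : gromovProduct dist 1 (x * (f * y⁻¹))⁻¹ y =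
      (len (x * (f * y⁻¹)) + len y - len (x * f)) / 2 := by
    have e : (x * (f * y⁻¹))⁻¹ = y * (x * f)⁻¹ := by group
    have := hd.left_invariant y (x * f)⁻¹ 1
    rw [mul_one] at this
    rw [← hd.len_inv (x * (f * y⁻¹)), ← hd.len_inv (x * f), e]
    unfold gromovProduct
    rw [this]
    rfl
  have hxf : len (x * f) ≤ len x + M := by
    have h1 := dist_triangle f 1 x⁻¹
    have h2 := hd.len_inv x
    rw [hd.len_mul]
    unfold len at *
    rw [dist_comm 1] at h1
    linarith
  refine ⟨x * (f * y⁻¹), by linarith, by linarith, ?_, ?_⟩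
  · filter_upwards [hx3] with j hj
    have := hδ.trans (t := R / 2 - C - 2 * M - 2 * C') (o := 1) (x := x * (f * y⁻¹)) (z := x)
      (y := s j) (by linarith) (by linarith)
    linarith
  · filter_upwards [hy3] with j hj
    have := hδ.trans (t := R / 2 - C - 2 * M - 2 * C') (o := 1) (x := (x * (f * y⁻¹))⁻¹) (z := y)
      (y := s' j) (by linarith) (by linarith)
    linarith

/-- If `g` points towards both `p` and the limit of `s` up to distance `a`, then so does `p`. -/
theorem FourPoint.le_extGromovProduct {X : Type*} [MetricSpace X] {δ : ℝ} (hδ : FourPoint X δ)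
    (o g : X) (p : GromovBoundary o) (s : ℕ → X) (hs : TendsToInfinity o s) (a : ℝ)
    (hp : (a : EReal) < extGromovProduct o (Sum.inl g) (Sum.inr p))
    (hgs : ∀ᶠ j in atTop, a ≤ gromovProduct dist o g (s j)) :
    ((a - δ : ℝ) : EReal) ≤
      extGromovProduct o (Sum.inr p) (Sum.inr (Quot.mk (SeqEquiv o) ⟨s, hs⟩)) := by
  unfold extGromovProduct at hp
  -- Strictness of `hp` yields a representative sequence whose liminf exceeds `a`.
  simp only [lt_iSup_iff] at hp
  obtain ⟨q, t, hq, ht, hlt⟩ := hp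
  have hq' : ∀ n, q n = g := hq
  have h1 : ∀ᶠ i in atTop, a ≤ gromovProduct dist o g (t i) := by
    filter_upwards [tendsto_atTop_diagonal.eventually (eventually_lt_of_lt_liminf hlt)] with i hi
    simp only [hq', EReal.coe_lt_coe_iff] at hi
    exact hi.le
  unfold extGromovProduct
  refine le_trans ?_ (le_iSup₂_of_le t s (le_iSup₂_of_le ht ⟨hs, rfl⟩ le_rfl))
  refine le_liminf_of_le (by isBoundedDefault) ?_
  rw [← prod_atTop_atTop_eq]
  filter_upwards [h1.prod_mk hgs] with ij hij
  rw [EReal.coe_le_coe_iff]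
  refine hδ.trans (z := g) ?_ hij.2
  rw [gromovProduct_symm]
  exact hij.1

/-- The multiplicative constant of the visual metric costs an additive `log C / ε` in the Gromov
product. -/
theorem dist_le_of_le_extGromovProduct {X : Type*} [MetricSpace X] {o : X}
    [MetricSpace (GromovBoundary o)] {ε C a b : ℝ} (hε : 0 < ε) (hC : 0 < C)
    {ξ η : GromovBoundary o}
    (h : edist ξ η ≤ ENNReal.ofReal C *
        EReal.exp (-((ε : EReal) * extGromovProduct o (Sum.inr ξ) (Sum.inr η))))
    (ha : (a : EReal) ≤ extGromovProduct o (Sum.inr ξ) (Sum.inr η))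
    (hab : Real.log C / ε + b ≤ a) : dist ξ η ≤ Real.exp (-(ε * b)) := by
  have h1 : -((ε : EReal) * extGromovProduct o (Sum.inr ξ) (Sum.inr η)) ≤ ((-(ε * a) : ℝ) : EReal) := by
    push_cast
    rw [EReal.neg_le_neg_iff]
    exact mul_le_mul_of_nonneg_left ha (EReal.coe_nonneg.2 hε.le)
  have h2 : edist ξ η ≤ ENNReal.ofReal (C * Real.exp (-(ε * a))) := by
    refine h.trans ?_
    rw [ENNReal.ofReal_mul hC.le, ← EReal.exp_coe]
    gcongr
  rw [edist_le_ofReal (by positivity)] at h2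
  refine h2.trans ?_
  have h3 : Real.log C + ε * b ≤ ε * a := by
    have := mul_le_mul_of_nonneg_left hab hε.le
    rwa [mul_add, mul_div_cancel₀ _ hε.ne'] at this
  rw [← Real.exp_log hC, ← Real.exp_add]
  exact Real.exp_le_exp.2 (by linarith)

end Covering
end BoundaryRep

theorem mainTheorem7 (Γ : Type*) [Group Γ] [MetricSpace Γ]
    (hΓ : BoundaryRep.IsHyperbolicGroup Γ) (hne : BoundaryRep.IsNonElementary Γ)
    (hd : BoundaryRep.MetricInClassD Γ) :
    ∃ r₀ : ℝ, 0 < r₀ ∧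
      ∀ r : ℝ, r₀ ≤ r →
      ∀ ε : ℝ, 0 < ε →
      ∀ [MetricSpace (BoundaryRep.GromovBoundary (1 : Γ))],
        BoundaryRep.IsVisualMetric (1 : Γ) ε →
      ∀ hat : Γ → BoundaryRep.GromovBoundary (1 : Γ), BoundaryRep.IsHatMap hat →
      ∃ ρ₀ : ℝ, 0 < ρ₀ ∧
        ∀ ρ : ℝ, ρ₀ ≤ ρ →
        ∀ R : ℝ, 0 < R →
          (⋃ g ∈ BoundaryRep.annulus Γ r R, BoundaryRep.doubleShadow ε hat g ρ) = Set.univ := by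
  obtain ⟨C, hC, hel⟩ := hd.exists_element_toward hne
  obtain ⟨δ, hδ⟩ := hd.exists_fourPoint
  refine ⟨C + 1, by positivity, fun r hr ε hε _ hvis hat hhat => ?_⟩
  obtain ⟨Cv, hCv, hvis⟩ := hvis
  obtain ⟨Ch, hhat⟩ := hhat
  have hδ0 := hδ.nonneg 1
  set A := C + |Ch| + 1 with hA
  -- `A` puts `R / 2 - A` below both `|g| - Ch` and `R / 2 - C`; the four-point inequality loses
  -- `δ`, the visual metric `log Cv / ε`, and the last `C` covers `|g| / 2 - R / 2`.
  refine ⟨max 1 (Real.log Cv / ε + A + δ + C), by positivity, fun ρ hρ R hR => ?_⟩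
  have hρ' := (le_max_right _ _).trans hρ
  rw [Set.eq_univ_iff_forall]
  rintro ⟨ξ, η⟩
  obtain ⟨⟨s, hs⟩, rfl⟩ := Quot.exists_rep ξ
  obtain ⟨⟨s', hs'⟩, rfl⟩ := Quot.exists_rep η
  obtain ⟨g, hg1, hg2, hgs, hgs'⟩ := hel s s' hs hs' R hR
  have key : ∀ (h : Γ) (t : ℕ → Γ) (ht : BoundaryRep.TendsToInfinity 1 t)
      (ζ : BoundaryRep.GromovBoundary (1 : Γ)), Quot.mk (BoundaryRep.SeqEquiv 1) ⟨t, ht⟩ = ζ →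
      BoundaryRep.len h = BoundaryRep.len g →
      (∀ᶠ j in atTop, R / 2 - C ≤ BoundaryRep.gromovProduct dist 1 h (t j)) →
      ζ ∈ Metric.closedBall (hat h) (Real.exp (-(ε * (BoundaryRep.len g / 2 - ρ)))) := by
    intro h t ht ζ hζ hlen hev
    have hCh := le_abs_self Ch
    have h1 := hδ.le_extGromovProduct 1 h (hat h) t ht (R / 2 - A)
      (lt_of_lt_of_le (EReal.coe_lt_coe_iff.2 (by rw [hlen]; linarith)) (hhat h).1)
      (hev.mono fun j hj => by linarith [abs_nonneg Ch])
    rw [hζ] at h1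
    rw [Metric.mem_closedBall']
    exact BoundaryRep.dist_le_of_le_extGromovProduct hε hCv (hvis _ _).1 h1 (by linarith)
  refine Set.mem_biUnion (x := g) ⟨by linarith, by linarith⟩ ⟨key g s hs _ rfl rfl hgs, ?_⟩
  exact key g⁻¹ s' hs' _ rfl (hd.len_inv g) hgs'
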